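/- Let $G$ be a complex semisimple Lie group, i.e. a complex Lie group with finitely many connected components whose Lie algebra $\mathfrak g$ is semisimple. Fix a Cartan subalgebra $\mathfrak h\subset\mathfrak g$ and a system $\Delta$ of simple roots, let $W$ be the Weyl group of the root system of $(\mathfrak g,\mathfrak h)$, generated by the simple reflections $S=\{r_\alpha:\alpha\in\Delta\}$, let $\ell$ be the word length of $W$ with respect to $S$, and let $w_0$ be the longest element of $W$. For $x,y\in W$ write $x\le y$ (Chevalley–Bruhat order) if $x$ is represented by a subword of a reduced word for $y$. An ideal is a subset $I\subset W$ such that $y\in I$ and $x<y$ imply $x\in I$; it is called fat if $w_0(W\setminus I)\subset I$. The simple factors of $G$ are the simple ideals of $\mathfrak g$. **Theorem.** Let $I\subset W$ be a fat ideal. (i) If $G$ has no simple factor of type $A_1$, then $I$ contains each $w\in W$ with $\ell(w)\le 1$. (ii) If $G$ has no simple factor of type $A_1$, $A_2$, $A_3$ or $B_2$, then $I$ contains each $w\in W$ with $\ell(w)\le 2$. -/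

import Mathlib

open scoped Manifold

noncomputable section

namespace WeylIdeals

section Bruhat

variable {ι R M N : Type*} [CommRing R] [AddCommGroup M] [Module R M]
  [AddCommGroup N] [Module R N] {P : RootPairing ι R M N}

/-- The element of the Weyl group represented by a word in the simple reflections. -/
def wordProd (b : P.Base) (l : List b.support) : P.weylGroup :=
  (l.map fun i => RootPairing.weylGroup.ofIdx P (i : ι)).prod

/-- The length function: the least length of a word in the simple reflections representing `w`. -/
def length (b : P.Base) (w : P.weylGroup) : ℕ :=
  sInf {n | ∃ l : List b.support, l.length = n ∧ wordProd b l = w}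

/-- A word is reduced if it has minimal length among all words representing the same element. -/
def IsReducedWord (b : P.Base) (l : List b.support) : Prop :=
  ∀ l' : List b.support, wordProd b l' = wordProd b l → l.length ≤ l'.length

/-- The (non-strict) Chevalley-Bruhat order: `x ≤ y` if `x` is represented by a subword
of a reduced word for `y`. -/
def BruhatLE (b : P.Base) (x y : P.weylGroup) : Prop :=
  ∃ l : List b.support, IsReducedWord b l ∧ wordProd b l = y ∧
    ∃ l' : List b.support, l'.Sublist l ∧ wordProd b l' = x

/-- The strict Chevalley-Bruhat order. -/
def BruhatLT (b : P.Base) (x y : P.weylGroup) : Prop :=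
  BruhatLE b x y ∧ x ≠ y

/-- A Chevalley-Bruhat ideal: a downward closed subset of the Weyl group. -/
def IsBruhatIdeal (b : P.Base) (I : Set P.weylGroup) : Prop :=
  ∀ x y : P.weylGroup, y ∈ I → BruhatLT b x y → x ∈ I

/-- The Weyl group of a finite root system is finite. -/
theorem finite_weylGroup (P : RootPairing ι R M N) [Finite ι] [P.IsRootSystem] :
    Finite P.weylGroup := by
  refine Finite.of_injective (fun g : P.weylGroup => P.weylGroupToPerm g) ?_
  intro g h hgh
  apply Subtype.ext
  apply RootPairing.Equiv.weightHom_injective P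
  apply LinearEquiv.toLinearMap_injective
  apply LinearMap.ext_on_range (v := P.root) RootPairing.IsRootSystem.span_root_eq_top
  intro i
  have key : ∀ g : P.weylGroup, g • P.root i = P.root (P.weylGroupToPerm g i) :=
    fun g => P.weylGroup_apply_root g i
  have := (key g).trans ((congrArg (fun e => P.root (e i)) hgh).trans (key h).symm)
  exact this

theorem exists_longest [Finite ι] [P.IsRootSystem] (b : P.Base) :
    ∃ w₀ : P.weylGroup, ∀ w : P.weylGroup, length b w ≤ length b w₀ :=
  haveI := finite_weylGroup P
  Finite.exists_max (length b)

/-- The longest element `w₀` of the Weyl group, at which the length attains its maximum. -/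
def longestElement [Finite ι] [P.IsRootSystem] (b : P.Base) : P.weylGroup :=
  (exists_longest b).choose

/-- The orthogonal `I^⊥ = w₀ (W \ I)`. -/
def orthogonal [Finite ι] [P.IsRootSystem] (b : P.Base) (I : Set P.weylGroup) :
    Set P.weylGroup :=
  (fun w => longestElement b * w) '' Iᶜ

/-- A set `I` of Weyl group elements is fat if it contains its orthogonal. -/
def IsFat [Finite ι] [P.IsRootSystem] (b : P.Base) (I : Set P.weylGroup) : Prop :=
  orthogonal b I ⊆ I

end Bruhat

/-- A complex simple Lie algebra has the Cartan type given by the matrix `C` if, for a Cartan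
subalgebra and a system of simple roots, its Cartan matrix is `C` up to relabelling. -/
def HasCartanType (L : Type*) [LieRing L] [LieAlgebra ℂ L] [FiniteDimensional ℂ L]
    [LieAlgebra.IsSimple ℂ L] {n : ℕ} (C : Matrix (Fin n) (Fin n) ℤ) : Prop :=
  ∃ (H : LieSubalgebra ℂ L) (_ : H.IsCartanSubalgebra)
    (b : (LieAlgebra.IsKilling.rootSystem H).Base) (e : b.support ≃ Fin n),
    ∀ i j, b.cartanMatrix i j = C (e i) (e j)

/-- The Lie algebra `L` has a simple factor (a simple ideal) of the Cartan type given by `C`. -/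
def HasFactorOfType (L : Type*) [LieRing L] [LieAlgebra ℂ L] [FiniteDimensional ℂ L]
    {n : ℕ} (C : Matrix (Fin n) (Fin n) ℤ) : Prop :=
  ∃ (I : LieIdeal ℂ L) (_ : LieAlgebra.IsSimple ℂ I), HasCartanType I C

instance finiteDimensional_groupLieAlgebra (E : Type*) [NormedAddCommGroup E] [NormedSpace ℂ E]
    [FiniteDimensional ℂ E] (G : Type*) [TopologicalSpace G] [ChartedSpace E G] [Group G] :
    FiniteDimensional ℂ (GroupLieAlgebra 𝓘(ℂ, E) G) :=
  inferInstanceAs (FiniteDimensional ℂ E)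

instance completeSpace_of_finiteDimensional_complex (E : Type*) [NormedAddCommGroup E]
    [NormedSpace ℂ E] [FiniteDimensional ℂ E] : CompleteSpace E :=
  FiniteDimensional.complete ℂ E

end WeylIdeals

end

noncomputable section

namespace WeylIdeals

section

open RootPairing

/-! ### Words, inversions and the longest element. -/

section Coxeter

variable {ι R M N : Type*} [Field R] [AddCommGroup M] [Module R M]
  [AddCommGroup N] [Module R N] {P : RootPairing ι R M N} (b : P.Base)

/-! If `w ∉ I`, fatness gives `w₀ w ∈ I`; so as soon as `w ≤ w₀ w`, the ideal property forces `w ∈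
I` (`IsFat.mem_of_bruhatLE`). It remains to prove `w ≤ w₀ w` for short `w`.

Let `l'` be a reduced word for `w`, and suppose some word `l` contains `l'` as a subword and `l`
followed by the reverse of `l'` is reduced. Its inverse can be extended on the left to a reduced
expression of `w₀`; deleting the part spelling `w` leaves a reduced word for `w₀ w` ending in `l`
(`bruhatLE_longestElement_mul`). Such an `l` is found inside a few neighbouring nodes of the Dynkin
diagram: `[s, t]` for `w = s` with `t` a neighbour of `s`, and for `w = st` one of the words in
`bruhatLE_pair`. Length equals the number of inversions, so reducedness is tested letter by letter
on signs of roots, read off from the Cartan matrix.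

The search for `l` fails only when a whole component of the diagram is too small.
`hasFactorOfType_of_component` turns such a component into a simple ideal with the same Cartan
matrix, which the hypotheses on simple factors exclude. -/

lemma ofIdx_mul_self (i : ι) : weylGroup.ofIdx P i * weylGroup.ofIdx P i = 1 := by
  apply Subtype.ext
  change Equiv.reflection P i * Equiv.reflection P i = 1
  rw [mul_eq_one_iff_inv_eq, Equiv.reflection_inv P i]

lemma ofIdx_inv (i : ι) : (weylGroup.ofIdx P i)⁻¹ = weylGroup.ofIdx P i :=
  inv_eq_of_mul_eq_one_left (ofIdx_mul_self i)

@[simp]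
lemma weylGroupToPerm_ofIdx (i : ι) :
    P.weylGroupToPerm (weylGroup.ofIdx P i) = P.reflectionPerm i :=
  Equiv.reflection_indexEquiv P i

@[simp] lemma wordProd_nil : wordProd b [] = 1 := rfl

@[simp] lemma wordProd_cons (i : b.support) (l : List b.support) :
    wordProd b (i :: l) = weylGroup.ofIdx P (i : ι) * wordProd b l := rfl

lemma wordProd_append (l l' : List b.support) :
    wordProd b (l ++ l') = wordProd b l * wordProd b l' := by
  simp [wordProd]

lemma wordProd_reverse (l : List b.support) :
    wordProd b l.reverse = (wordProd b l)⁻¹ := by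
  induction l with
  | nil => simp
  | cons i l ih => simp [wordProd_append, ih, ofIdx_inv]

lemma weylGroupToPerm_injective [P.IsRootSystem] :
    Function.Injective P.weylGroupToPerm := by
  intro g h hgh
  apply Subtype.ext
  apply RootPairing.Equiv.weightHom_injective P
  apply LinearEquiv.toLinearMap_injective
  apply LinearMap.ext_on_range (v := P.root) RootPairing.IsRootSystem.span_root_eq_top
  intro i
  exact ((P.weylGroup_apply_root g i).trans
    (congrArg (fun e => P.root (e i)) hgh)).trans (P.weylGroup_apply_root h i).symm

/-- The reflection in a root conjugated by a Weyl group element. -/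
lemma ofIdx_weylGroupToPerm [P.IsRootSystem] (w : P.weylGroup) (i : ι) :
    weylGroup.ofIdx P (P.weylGroupToPerm w i) = w * weylGroup.ofIdx P i * w⁻¹ := by
  rw [eq_mul_inv_iff_mul_eq]
  obtain ⟨w, hw⟩ := w
  induction hw using weylGroup.induction generalizing i with
  | one =>
    apply Subtype.ext
    simp
  | mem j =>
    apply weylGroupToPerm_injective
    change P.weylGroupToPerm (weylGroup.ofIdx P (P.weylGroupToPerm (weylGroup.ofIdx P j) i) *
      weylGroup.ofIdx P j) = P.weylGroupToPerm (weylGroup.ofIdx P j * weylGroup.ofIdx P i)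
    simp only [map_mul, weylGroupToPerm_ofIdx]
    ext k
    apply P.root.injective
    simp only [Equiv.Perm.mul_apply, root_reflectionPerm, reflection_reflectionPerm]
    simp
  | mul x y hx hy ihx ihy =>
    rw [← Submonoid.mk_mul_mk _ _ _ hx hy, map_mul, Equiv.Perm.mul_apply, ← mul_assoc, ihx,
      mul_assoc, ihy, mul_assoc]

lemma reflectionPerm_self_self (i : ι) :
    P.reflectionPerm (P.reflectionPerm i i) (P.reflectionPerm i i) = i := by
  apply P.root.injective
  rw [root_reflectionPerm, reflection_apply_self, root_reflectionPerm, reflection_apply_self,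
    neg_neg]

lemma weylGroupToPerm_indexNeg (w : P.weylGroup) (i : ι) :
    P.weylGroupToPerm w (P.reflectionPerm i i) =
      P.reflectionPerm (P.weylGroupToPerm w i) (P.weylGroupToPerm w i) := by
  apply P.root.injective
  rw [← P.weylGroup_apply_root]
  simp only [root_reflectionPerm, reflection_apply_self, smul_neg]
  rw [P.weylGroup_apply_root]

/-- Otherwise fatness would put `w₀ w` in the ideal, and `w` lies below it. -/
lemma IsFat.mem_of_bruhatLE [Finite ι] [P.IsRootSystem] {b : P.Base} {I : Set P.weylGroup} (hI : IsBruhatIdeal b I)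
    (hfat : IsFat b I) {w : P.weylGroup} (hw : BruhatLE b w (longestElement b * w)) : w ∈ I := by
  by_contra h
  have h1 : longestElement b * w ∈ I := hfat ⟨w, h, rfl⟩
  by_cases h2 : w = longestElement b * w
  · exact h (h2 ▸ h1)
  · exact h (hI _ _ h1 ⟨hw, h2⟩)

variable [CharZero R]

/-- The positive roots made negative by `w`. -/
def inversions (w : P.weylGroup) : Set ι :=
  {i | b.IsPos i ∧ ¬ b.IsPos (P.weylGroupToPerm w i)}

/-- The number of positive roots made negative by `w`. -/
def inversionNumber (w : P.weylGroup) : ℕ := (inversions b w).ncard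

@[simp] lemma inversionNumber_one : inversionNumber b (1 : P.weylGroup) = 0 := by
  have : inversions b (1 : P.weylGroup) = ∅ := by
    ext i; simp [inversions]
  simp [inversionNumber, this]

lemma isPos_reflectionPerm_self (i : ι) :
    b.IsPos (P.reflectionPerm i i) ↔ ¬ b.IsPos i :=
  Base.IsPos.neg_iff_not b i

/-- The map `α ↦ -w⁻¹α` is a bijection from the inversions of `w⁻¹` to those of `w`. -/
lemma inversionNumber_inv (w : P.weylGroup) :
    inversionNumber b w⁻¹ = inversionNumber b w := by
  refine Set.ncard_congr
    (fun i _ => P.weylGroupToPerm w⁻¹ (P.reflectionPerm i i)) ?_ ?_ ?_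
  · rintro i ⟨h1, h2⟩
    refine ⟨?_, ?_⟩
    · rw [weylGroupToPerm_indexNeg, isPos_reflectionPerm_self]
      exact h2
    · rw [← Equiv.Perm.mul_apply, ← map_mul]
      simpa [isPos_reflectionPerm_self] using h1
  · intro i j _ _ hij
    have := (P.weylGroupToPerm w⁻¹).injective hij
    have h2 := congrArg P.root this
    simp only [root_reflectionPerm, reflection_apply_self, neg_inj] at h2
    exact P.root.injective h2
  · rintro i ⟨h1, h2⟩
    refine ⟨P.reflectionPerm (P.weylGroupToPerm w i) (P.weylGroupToPerm w i), ⟨?_, ?_⟩, ?_⟩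
    · rwa [isPos_reflectionPerm_self]
    · rw [← weylGroupToPerm_indexNeg, ← Equiv.Perm.mul_apply, ← map_mul]
      simpa [isPos_reflectionPerm_self] using h1
    · simp only [← weylGroupToPerm_indexNeg]
      rw [reflectionPerm_self_self, ← Equiv.Perm.mul_apply,
        ← map_mul]
      simp

variable [Finite ι] [P.IsCrystallographic] [P.IsReduced]

/-- A simple reflection permutes the positive roots other than its own root, so it carries the
inversions of `w` to those of the product, with `i` as the only new one. -/
lemma inversionNumber_mul_ofIdx {i : ι} (hi : i ∈ b.support) (w : P.weylGroup)
    (hw : b.IsPos (P.weylGroupToPerm w i)) :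
    inversionNumber b (w * weylGroup.ofIdx P i) = inversionNumber b w + 1 := by
  have hpi : b.IsPos i := Base.isPos_of_mem_support hi
  have h1 : inversions b (w * weylGroup.ofIdx P i) =
      insert i ((P.reflectionPerm i) '' (inversions b w)) := by
    ext k
    simp only [inversions, map_mul, weylGroupToPerm_ofIdx, Equiv.Perm.mul_apply,
      Set.mem_ofPred_eq, Set.mem_insert_iff, Set.mem_image]
    constructor
    · rintro ⟨hk, hk'⟩
      by_cases hki : k = i
      · exact Or.inl hki
      · exact Or.inr ⟨P.reflectionPerm i k, ⟨hk.reflectionPerm hi hki, hk'⟩, by simp⟩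
    · rintro (rfl | ⟨m, ⟨hm, hm'⟩, rfl⟩)
      · refine ⟨hpi, ?_⟩
        rw [weylGroupToPerm_indexNeg, isPos_reflectionPerm_self, not_not]
        exact hw
      · refine ⟨hm.reflectionPerm hi (by rintro rfl; exact hm' hw), by simpa using hm'⟩
  rw [inversionNumber, h1, Set.ncard_insert_of_notMem _ (Set.toFinite _),
    Set.ncard_image_of_injective _ (Equiv.injective _), inversionNumber]
  rintro ⟨m, ⟨hm, hm'⟩, hmi⟩
  have : m = P.reflectionPerm i i := (P.reflectionPerm i).injective (by simpa using hmi)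
  rw [this, isPos_reflectionPerm_self] at hm
  exact hm hpi

lemma inversionNumber_mul_ofIdx_of_not {i : ι} (hi : i ∈ b.support) (w : P.weylGroup)
    (hw : ¬ b.IsPos (P.weylGroupToPerm w i)) :
    inversionNumber b (w * weylGroup.ofIdx P i) + 1 = inversionNumber b w := by
  have h := inversionNumber_mul_ofIdx b hi (w * weylGroup.ofIdx P i) (by
    rwa [map_mul, Equiv.Perm.mul_apply, weylGroupToPerm_ofIdx, weylGroupToPerm_indexNeg,
      isPos_reflectionPerm_self])
  rw [← h, mul_assoc, ofIdx_mul_self, mul_one]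

lemma inversionNumber_wordProd_le (l : List b.support) :
    inversionNumber b (wordProd b l) ≤ l.length := by
  induction l using List.reverseRecOn with
  | nil => simp
  | append_singleton l i ih =>
    rw [wordProd_append]
    simp only [wordProd_cons, wordProd_nil, mul_one, List.length_append, List.length_singleton]
    by_cases h : b.IsPos (P.weylGroupToPerm (wordProd b l) i)
    · rw [inversionNumber_mul_ofIdx b i.2 _ h]; lia
    · have := inversionNumber_mul_ofIdx_of_not b i.2 _ h
      lia

variable [P.IsRootSystem]

/-- The exchange condition. -/
lemma exists_wordProd_eq_mul_of_not_isPos (l : List b.support) (j : b.support)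
    (h : ¬ b.IsPos (P.weylGroupToPerm (wordProd b l) j)) :
    ∃ l' : List b.support, l'.length + 1 = l.length ∧
      wordProd b l' = wordProd b l * weylGroup.ofIdx P (j : ι) := by
  induction l with
  | nil => simp [Base.isPos_of_mem_support j.2] at h
  | cons i l ih =>
    by_cases h1 : b.IsPos (P.weylGroupToPerm (wordProd b l) j)
    -- The letter `i` makes a positive root negative, so that root is `i` itself; the conjugation
    -- formula then cancels this letter.
    · have h2 : P.weylGroupToPerm (wordProd b l) j = i := by
        by_contra hne
        apply h
        rw [wordProd_cons, map_mul, Equiv.Perm.mul_apply, weylGroupToPerm_ofIdx]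
        exact h1.reflectionPerm i.2 hne
      refine ⟨l, rfl, ?_⟩
      rw [wordProd_cons, ← h2, ofIdx_weylGroupToPerm]
      simp [mul_assoc, ofIdx_mul_self]
    · obtain ⟨l', hl, hl'⟩ := ih h1
      exact ⟨i :: l', by simp [hl], by simp [hl', mul_assoc]⟩

/-- Prefixes of reduced words are reduced, and the last letter must create an inversion, since
otherwise the exchange condition would shorten the word. -/
lemma IsReducedWord.length_eq {b : P.Base} {l : List b.support} (hl : IsReducedWord b l) :
    l.length = inversionNumber b (wordProd b l) := by
  induction l using List.reverseRecOn with
  | nil => simp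
  | append_singleton l i ih =>
    have hl1 : IsReducedWord b l := by
      intro l' hl'
      have := hl (l' ++ [i]) (by simp [wordProd_append, hl'])
      simpa using this
    have hpos : b.IsPos (P.weylGroupToPerm (wordProd b l) i) := by
      by_contra hneg
      obtain ⟨l', h1, h2⟩ := exists_wordProd_eq_mul_of_not_isPos b l i hneg
      have := hl l' (by simp [wordProd_append, h2])
      simp at this
      lia
    rw [wordProd_append]
    simp only [wordProd_cons, wordProd_nil, mul_one, List.length_append, List.length_singleton]
    rw [inversionNumber_mul_ofIdx b i.2 _ hpos, ih hl1]

lemma isReducedWord_iff {l : List b.support} :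
    IsReducedWord b l ↔ l.length = inversionNumber b (wordProd b l) :=
  ⟨fun h => h.length_eq, fun h l' hl' => by
    rw [h, ← hl']; exact inversionNumber_wordProd_le b l'⟩

lemma exists_wordProd_eq_ofIdx (i : ι) :
    ∃ l : List b.support, wordProd b l = weylGroup.ofIdx P i := by
  induction i using b.induction_reflect with
  | h₀ i hi =>
    obtain ⟨l, hl⟩ := hi
    refine ⟨l, hl.trans ?_⟩
    have := ofIdx_weylGroupToPerm (weylGroup.ofIdx P i) i
    rw [weylGroupToPerm_ofIdx] at this
    rw [this, ofIdx_mul_self, one_mul, ofIdx_inv]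
  | h₁ i hi => exact ⟨[⟨i, hi⟩], by simp⟩
  | h₂ i j hi hj =>
    obtain ⟨l, hl⟩ := hi
    refine ⟨[⟨j, hj⟩] ++ l ++ [⟨j, hj⟩], ?_⟩
    have := ofIdx_weylGroupToPerm (weylGroup.ofIdx P j) i
    rw [weylGroupToPerm_ofIdx] at this
    rw [this, ofIdx_inv]
    simp [wordProd_append, hl, mul_assoc]

lemma exists_wordProd_eq (w : P.weylGroup) : ∃ l : List b.support, wordProd b l = w := by
  obtain ⟨w, hw⟩ := w
  induction hw using weylGroup.induction with
  | one => exact ⟨[], rfl⟩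
  | mem j => exact exists_wordProd_eq_ofIdx b j
  | mul x y hx hy ihx ihy =>
    obtain ⟨l, hl⟩ := ihx
    obtain ⟨l', hl'⟩ := ihy
    exact ⟨l ++ l', by rw [wordProd_append, hl, hl']; rfl⟩

lemma exists_isReducedWord (w : P.weylGroup) :
    ∃ l : List b.support, IsReducedWord b l ∧ wordProd b l = w ∧ l.length = length b w := by
  have hne : {n | ∃ l : List b.support, l.length = n ∧ wordProd b l = w}.Nonempty := by
    obtain ⟨l, hl⟩ := exists_wordProd_eq b w
    exact ⟨_, l, rfl, hl⟩
  obtain ⟨l, hl, hl'⟩ := Nat.sInf_mem hne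
  refine ⟨l, fun l' h => ?_, hl', hl⟩
  rw [hl]
  exact Nat.sInf_le ⟨l', rfl, h.trans hl'⟩

lemma length_eq_inversionNumber (w : P.weylGroup) : length b w = inversionNumber b w := by
  obtain ⟨l, hl, rfl, h⟩ := exists_isReducedWord b w
  rw [← h, hl.length_eq]

/-- A simple root kept positive would give a longer element, against maximality. Other positive
roots follow by adding simple roots, since heights add. -/
lemma not_isPos_longestElement {i : ι} (hi : b.IsPos i) :
    ¬ b.IsPos (P.weylGroupToPerm (longestElement b) i) := by
  have key : ∀ j ∈ b.support, ¬ b.IsPos (P.weylGroupToPerm (longestElement b) j) := by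
    intro j hj hpos
    have h1 := inversionNumber_mul_ofIdx b hj _ hpos
    have h2 := (exists_longest b).choose_spec (longestElement b * weylGroup.ofIdx P j)
    change length b _ ≤ length b (longestElement b) at h2
    rw [length_eq_inversionNumber, length_eq_inversionNumber] at h2
    lia
  refine Base.IsPos.induction_on_add hi
    (p := fun i => ¬ b.IsPos (P.weylGroupToPerm (longestElement b) i)) key ?_
  · intro i j k hk hi hj
    have hj' := key j hj
    have hadd : P.root (P.weylGroupToPerm (longestElement b) k) =
        P.root (P.weylGroupToPerm (longestElement b) i) +
        P.root (P.weylGroupToPerm (longestElement b) j) := by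
      simp only [← P.weylGroup_apply_root, hk, smul_add]
    rw [Base.isPos_iff] at hi hj' ⊢
    rw [b.height_add hadd]
    lia

lemma isPos_longestElement_iff (i : ι) :
    b.IsPos (P.weylGroupToPerm (longestElement b) i) ↔ ¬ b.IsPos i := by
  refine ⟨fun h h' => not_isPos_longestElement b h' h, fun h => ?_⟩
  rw [← isPos_reflectionPerm_self] at h
  have := not_isPos_longestElement b h
  rwa [weylGroupToPerm_indexNeg, isPos_reflectionPerm_self, not_not] at this

/-- As `w₀` reverses all signs, the inversions of `w₀ w` are the positive roots that are not
inversions of `w`. -/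
lemma inversionNumber_longestElement_mul (w : P.weylGroup) :
    inversionNumber b (longestElement b * w) + inversionNumber b w = {i | b.IsPos i}.ncard := by
  rw [inversionNumber, inversionNumber, ← Set.ncard_union_eq]
  · congr 1
    ext i
    simp only [inversions, map_mul, Equiv.Perm.mul_apply, isPos_longestElement_iff, not_not,
      Set.mem_union, Set.mem_ofPred_eq]
    tauto
  · rw [Set.disjoint_left]
    rintro i ⟨_, h⟩ ⟨_, h'⟩
    simp only [map_mul, Equiv.Perm.mul_apply, isPos_longestElement_iff, not_not] at h
    exact h' h

/-- If a word for `w` is a subword of `l` and `l` followed by the reversed word is reduced, then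
`w ≤ w₀ w`. -/
lemma bruhatLE_longestElement_mul {l l' : List b.support} (hsub : l'.Sublist l)
    (hl' : inversionNumber b (wordProd b l') = l'.length)
    (hl : inversionNumber b (wordProd b (l ++ l'.reverse)) = l.length + l'.length) :
    BruhatLE b (wordProd b l') (longestElement b * wordProd b l') := by
  -- With this `u`, the word `u ++ l` spells `w₀ w`. If `N` is the number of positive roots, `u` has
  -- length `N - |l| - |l'|`, so `u ++ l` has length `N - |l'|`, the length of `w₀ w`.
  obtain ⟨u, hu, hu', -⟩ :=
    exists_isReducedWord b (longestElement b * (wordProd b (l ++ l'.reverse))⁻¹)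
  have hprod : wordProd b (u ++ l) = longestElement b * wordProd b l' := by
    rw [wordProd_append, hu', wordProd_append, wordProd_reverse]
    group
  refine ⟨u ++ l, ?_, hprod, l', hsub.trans (List.sublist_append_right u l), rfl⟩
  rw [isReducedWord_iff, hprod, List.length_append, hu.length_eq, hu']
  have h1 := inversionNumber_longestElement_mul b (wordProd b (l ++ l'.reverse))⁻¹
  have h2 := inversionNumber_longestElement_mul b (wordProd b l')
  rw [inversionNumber_inv, hl] at h1
  lia

end Coxeter

end

/-! ### Positivity of roots from Cartan matrix coordinates. -/

section

open RootPairing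

/-- The action of the `i`-th simple reflection on coordinates with respect to the simple roots,
in terms of the Cartan matrix. -/
def reflectCoords {n : ℕ} (A : Matrix (Fin n) (Fin n) ℤ) (i : Fin n) (c : Fin n → ℤ) :
    Fin n → ℤ :=
  fun k => if k = i then c k - ∑ j, c j * A j i else c k

section Coordinates

variable (A₂ : Matrix (Fin 2) (Fin 2) ℤ) (A₃ : Matrix (Fin 3) (Fin 3) ℤ)
  (A₄ : Matrix (Fin 4) (Fin 4) ℤ) (x y z w : ℤ)

@[simp] lemma reflectCoords_two_zero : reflectCoords A₂ 0 ![x, y] =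
    ![x - (x * A₂ 0 0 + y * A₂ 1 0), y] := by
  ext k; fin_cases k <;> simp [reflectCoords, Fin.sum_univ_succ]

@[simp] lemma reflectCoords_two_one : reflectCoords A₂ 1 ![x, y] =
    ![x, y - (x * A₂ 0 1 + y * A₂ 1 1)] := by
  ext k; fin_cases k <;> simp [reflectCoords, Fin.sum_univ_succ]

@[simp] lemma reflectCoords_three_zero : reflectCoords A₃ 0 ![x, y, z] =
    ![x - (x * A₃ 0 0 + y * A₃ 1 0 + z * A₃ 2 0), y, z] := by
  ext k; fin_cases k <;> simp [reflectCoords, Fin.sum_univ_succ, add_assoc]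

@[simp] lemma reflectCoords_three_one : reflectCoords A₃ 1 ![x, y, z] =
    ![x, y - (x * A₃ 0 1 + y * A₃ 1 1 + z * A₃ 2 1), z] := by
  ext k; fin_cases k <;> simp [reflectCoords, Fin.sum_univ_succ, add_assoc]

@[simp] lemma reflectCoords_three_two : reflectCoords A₃ 2 ![x, y, z] =
    ![x, y, z - (x * A₃ 0 2 + y * A₃ 1 2 + z * A₃ 2 2)] := by
  ext k; fin_cases k <;> simp [reflectCoords, Fin.sum_univ_succ, add_assoc]

@[simp] lemma reflectCoords_four_zero : reflectCoords A₄ 0 ![x, y, z, w] =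
    ![x - (x * A₄ 0 0 + y * A₄ 1 0 + z * A₄ 2 0 + w * A₄ 3 0), y, z, w] := by
  ext k; fin_cases k <;> simp [reflectCoords, Fin.sum_univ_succ, add_assoc]

@[simp] lemma reflectCoords_four_one : reflectCoords A₄ 1 ![x, y, z, w] =
    ![x, y - (x * A₄ 0 1 + y * A₄ 1 1 + z * A₄ 2 1 + w * A₄ 3 1), z, w] := by
  ext k; fin_cases k <;> simp [reflectCoords, Fin.sum_univ_succ, add_assoc]

@[simp] lemma reflectCoords_four_two : reflectCoords A₄ 2 ![x, y, z, w] =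
    ![x, y, z - (x * A₄ 0 2 + y * A₄ 1 2 + z * A₄ 2 2 + w * A₄ 3 2), w] := by
  ext k; fin_cases k <;> simp [reflectCoords, Fin.sum_univ_succ, add_assoc]

@[simp] lemma reflectCoords_four_three : reflectCoords A₄ 3 ![x, y, z, w] =
    ![x, y, z, w - (x * A₄ 0 3 + y * A₄ 1 3 + z * A₄ 2 3 + w * A₄ 3 3)] := by
  ext k; fin_cases k <;> simp [reflectCoords, Fin.sum_univ_succ, add_assoc]

@[simp] lemma single_two_zero : (Pi.single 0 1 : Fin 2 → ℤ) = ![1, 0] := by decide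
@[simp] lemma single_two_one : (Pi.single 1 1 : Fin 2 → ℤ) = ![0, 1] := by decide
@[simp] lemma single_three_zero : (Pi.single 0 1 : Fin 3 → ℤ) = ![1, 0, 0] := by decide
@[simp] lemma single_three_one : (Pi.single 1 1 : Fin 3 → ℤ) = ![0, 1, 0] := by decide
@[simp] lemma single_three_two : (Pi.single 2 1 : Fin 3 → ℤ) = ![0, 0, 1] := by decide
@[simp] lemma single_four_zero : (Pi.single 0 1 : Fin 4 → ℤ) = ![1, 0, 0, 0] := by decide
@[simp] lemma single_four_one : (Pi.single 1 1 : Fin 4 → ℤ) = ![0, 1, 0, 0] := by decide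
@[simp] lemma single_four_two : (Pi.single 2 1 : Fin 4 → ℤ) = ![0, 0, 1, 0] := by decide
@[simp] lemma single_four_three : (Pi.single 3 1 : Fin 4 → ℤ) = ![0, 0, 0, 1] := by decide

end Coordinates

section Words

variable {ι R M N : Type*} [Field R] [AddCommGroup M] [Module R M]
  [AddCommGroup N] [Module R N] {P : RootPairing ι R M N} {b : P.Base} {n : ℕ}
  (v : Fin n → b.support)

variable [P.IsCrystallographic]

/-- The Cartan matrix of a family of simple roots. -/
def subCartanMatrix : Matrix (Fin n) (Fin n) ℤ :=
  fun i j => b.cartanMatrix (v i) (v j)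

lemma ofIdx_smul_sum (i : Fin n) (c : Fin n → ℤ) :
    weylGroup.ofIdx P (v i : ι) • (∑ j, c j • P.root (v j)) =
      ∑ j, reflectCoords (subCartanMatrix v) i c j • P.root (v j) := by
  have h1 : ∑ j, reflectCoords (subCartanMatrix v) i c j • P.root (v j) =
      ∑ j, c j • P.root (v j) - (∑ j, c j * subCartanMatrix v j i) • P.root (v i) := by
    rw [← Finset.sum_erase_add _ _ (Finset.mem_univ i),
      ← Finset.sum_erase_add _ (fun j => c j • P.root (v j)) (Finset.mem_univ i)]
    have : ∀ j ∈ Finset.univ.erase i, reflectCoords (subCartanMatrix v) i c j • P.root (v j) =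
        c j • P.root (v j) := by
      intro j hj
      simp [reflectCoords, Finset.ne_of_mem_erase hj]
    rw [Finset.sum_congr rfl this]
    simp only [reflectCoords, if_true, sub_smul]
    abel
  rw [h1, weylGroup.ofIdx_smul, Equiv.reflection_smul, map_sum, Finset.sum_smul,
    ← Finset.sum_sub_distrib]
  refine Finset.sum_congr rfl fun j _ => ?_
  rw [map_zsmul, reflection_apply_root' ℤ, smul_sub, ← smul_assoc, smul_eq_mul]
  rfl

lemma wordProd_map_smul_sum (l : List (Fin n)) (c : Fin n → ℤ) :
    wordProd b (l.map v) • (∑ j, c j • P.root (v j)) =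
      ∑ j, l.foldr (reflectCoords (subCartanMatrix v)) c j • P.root (v j) := by
  induction l with
  | nil => simp
  | cons i l ih =>
    rw [List.map_cons, wordProd_cons, mul_smul, ih, ofIdx_smul_sum]
    rfl

variable [CharZero R]

omit [P.IsCrystallographic] in
-- The coordinates of a root in a base all have the same sign, so one positive coordinate decides.
lemma isPos_of_root_eq_sum {v : Fin n → b.support} (hv : Function.Injective v) {k : ι}
    {c : Fin n → ℤ} (hk : P.root k = ∑ j, c j • P.root (v j)) {j : Fin n} (hj : 0 < c j) :
    b.IsPos k := by
  classical
  -- Extension of `c` by zero to all indices; injectivity of `v` makes its value at `v j` equal to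
  -- `c j`.
  let f : ι → ℤ := fun x => ∑ j, if (v j : ι) = x then c j else 0
  have hfv (j : Fin n) : f (v j) = c j := by
    simp only [f]
    rw [Finset.sum_eq_single j]
    · simp
    · intro i _ hij
      rw [if_neg]
      intro h
      exact hij (hv (Subtype.ext h))
    · simp
  have hf₀ : f.support ⊆ b.support := by
    intro x hx
    by_contra hxs
    apply hx
    refine Finset.sum_eq_zero fun j _ => if_neg ?_
    rintro rfl
    exact hxs (v j).2
  have hsum : ∑ x ∈ b.support, f x • P.root x = P.root k := by
    rw [hk]
    simp only [f, Finset.sum_smul]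
    rw [Finset.sum_comm]
    refine Finset.sum_congr rfl fun j _ => ?_
    rw [Finset.sum_eq_single_of_mem (v j : ι) (v j).2]
    · simp
    · intro x _ hx
      simp [hx.symm]
  rcases b.pos_or_neg_of_sum_smul_root_mem f ⟨k, hsum.symm⟩ hf₀ with h | h
  · rw [Base.isPos_iff', Base.height_eq_sum hsum.symm]
    exact Finset.sum_nonneg fun i _ => h.le i
  · have := h.le (v j)
    rw [hfv] at this
    simp only [Pi.zero_apply] at this
    lia

lemma isPos_wordProd_of_coord_pos {v : Fin n → b.support} (hv : Function.Injective v)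
    (l : List (Fin n)) (i k : Fin n)
    (hk : 0 < l.foldr (reflectCoords (subCartanMatrix v)) (Pi.single i 1) k) :
    b.IsPos (P.weylGroupToPerm (wordProd b (l.map v)) (v i)) := by
  refine isPos_of_root_eq_sum hv (c := l.foldr (reflectCoords (subCartanMatrix v)) (Pi.single i 1))
    ?_ hk
  rw [← wordProd_map_smul_sum, ← P.weylGroup_apply_root]
  congr 1
  rw [Finset.sum_eq_single i]
  · simp
  · intro j _ hj
    simp [hj]
  · simp

variable [Finite ι] [P.IsReduced]

/-- One step of a reducedness certificate: `i` is the letter appended and `k` names a coordinate of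
the image of its simple root that is visibly positive. For a letter not yet used, `k = i` works, as
that coordinate stays 1. -/
lemma inversionNumber_wordProd_snoc {v : Fin n → b.support} (hv : Function.Injective v)
    {l : List (Fin n)} {m : ℕ} (h : inversionNumber b (wordProd b (l.map v)) = m) (i k : Fin n)
    (hk : 0 < l.foldr (reflectCoords (subCartanMatrix v)) (Pi.single i 1) k) :
    inversionNumber b (wordProd b ((l ++ [i]).map v)) = m + 1 := by
  rw [List.map_append, wordProd_append]
  simp only [List.map_cons, List.map_nil, wordProd_cons, wordProd_nil, mul_one]
  rw [inversionNumber_mul_ofIdx b (v i).2 _ (isPos_wordProd_of_coord_pos hv l i k hk), h]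

end Words

end

/-! ### Explicit reduced words and the order relation in length at most two. -/

section

open RootPairing

set_option linter.unusedSimpArgs false

section ReducedWords

lemma injective_two {α : Type*} {s t : α} (hst : s ≠ t) : Function.Injective ![s, t] := by
  intro i j; fin_cases i <;> fin_cases j <;> simp [hst, hst.symm]

lemma injective_three {α : Type*} {s t p : α} (hst : s ≠ t) (hsp : s ≠ p) (htp : t ≠ p) :
    Function.Injective ![s, t, p] := by
  intro i j; fin_cases i <;> fin_cases j <;> simp [hst, hst.symm, hsp, hsp.symm, htp, htp.symm]

lemma injective_four {α : Type*} {s t p q : α} (hst : s ≠ t) (hsp : s ≠ p) (htp : t ≠ p)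
    (hsq : s ≠ q) (htq : t ≠ q) (hpq : p ≠ q) : Function.Injective ![s, t, p, q] := by
  intro i j; fin_cases i <;> fin_cases j <;>
    simp [hst, hst.symm, hsp, hsp.symm, htp, htp.symm, hsq, hsq.symm, htq, htq.symm, hpq, hpq.symm]

variable {ι R M N : Type*} [Field R] [CharZero R] [Finite ι] [AddCommGroup M] [Module R M]
  [AddCommGroup N] [Module R N] {P : RootPairing ι R M N} [P.IsCrystallographic] [P.IsReduced]
  {b : P.Base} {s t p q : b.support}

lemma inversionNumber_wordProd_single (s : b.support) :
    inversionNumber b (wordProd b [s]) = 1 := by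
  simpa using inversionNumber_mul_ofIdx b s.2 1 (by simpa using Base.isPos_of_mem_support s.2)

lemma inversionNumber_wordProd_pair (hst : s ≠ t) :
    inversionNumber b (wordProd b [s, t]) = 2 := by
  have hv := injective_two hst
  have h0 : inversionNumber b (wordProd b (([] : List (Fin 2)).map ![s, t])) = 0 := by simp
  have h1 := inversionNumber_wordProd_snoc hv h0 0 0 (by
    simp [subCartanMatrix])
  exact inversionNumber_wordProd_snoc hv h1 1 1 (by
    simp [subCartanMatrix])

lemma inversionNumber_sts (hst : s ≠ t) (h₁ : b.cartanMatrix s t < 0) :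
    inversionNumber b (wordProd b [s, t, s]) = 3 := by
  have hv := injective_two hst
  have h0 : inversionNumber b (wordProd b (([] : List (Fin 2)).map ![s, t])) = 0 := by simp
  have h1 := inversionNumber_wordProd_snoc hv h0 0 0 (by
    simp [subCartanMatrix])
  have h2 := inversionNumber_wordProd_snoc hv h1 1 1 (by
    simp [subCartanMatrix])
  have h3 := inversionNumber_wordProd_snoc hv h2 0 1 (by
    simp [subCartanMatrix]
    nlinarith)
  exact h3

/-- With `a = a_st` and `c = a_ts`, the last step has `t`-coordinate `a(2 - ac)`, positive because
`ac ≥ 3`. -/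
lemma inversionNumber_ststs (hst : s ≠ t) (h₁ : b.cartanMatrix s t < 0)
    (h : 3 ≤ b.cartanMatrix s t * b.cartanMatrix t s) :
    inversionNumber b (wordProd b [s, t, s, t, s]) = 5 := by
  have hv := injective_two hst
  have h0 : inversionNumber b (wordProd b (([] : List (Fin 2)).map ![s, t])) = 0 := by simp
  have h1 := inversionNumber_wordProd_snoc hv h0 0 0 (by
    simp [subCartanMatrix])
  have h2 := inversionNumber_wordProd_snoc hv h1 1 1 (by
    simp [subCartanMatrix])
  have h3 := inversionNumber_wordProd_snoc hv h2 0 1 (by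
    simp [subCartanMatrix]
    nlinarith)
  have h4 := inversionNumber_wordProd_snoc hv h3 1 1 (by
    simp [subCartanMatrix]
    nlinarith)
  have h5 := inversionNumber_wordProd_snoc hv h4 0 1 (by
    simp [subCartanMatrix]
    nlinarith)
  exact h5

lemma inversionNumber_stpts (hst : s ≠ t) (hsp : s ≠ p) (htp : t ≠ p)
    (h₁ : b.cartanMatrix s t = 0) (h₂ : b.cartanMatrix t s = 0)
    (h₃ : b.cartanMatrix s p < 0) (h₄ : b.cartanMatrix t p < 0) :
    inversionNumber b (wordProd b [s, t, p, t, s]) = 5 := by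
  have hv := injective_three hst hsp htp
  have h0 : inversionNumber b (wordProd b (([] : List (Fin 3)).map ![s, t, p])) = 0 := by simp
  have h1 := inversionNumber_wordProd_snoc hv h0 0 0 (by
    simp [subCartanMatrix, h₁, h₂])
  have h2 := inversionNumber_wordProd_snoc hv h1 1 1 (by
    simp [subCartanMatrix, h₁, h₂])
  have h3 := inversionNumber_wordProd_snoc hv h2 2 2 (by
    simp [subCartanMatrix, h₁, h₂])
  have h4 := inversionNumber_wordProd_snoc hv h3 1 2 (by
    simp [subCartanMatrix, h₁, h₂]
    nlinarith)
  have h5 := inversionNumber_wordProd_snoc hv h4 0 2 (by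
    simp [subCartanMatrix, h₁, h₂]
    nlinarith)
  exact h5

lemma inversionNumber_stpsts (hst : s ≠ t) (hsp : s ≠ p) (htp : t ≠ p)
    (h₁ : b.cartanMatrix s t < 0) (h₂ : b.cartanMatrix t s < 0)
    (h₃ : b.cartanMatrix s p ≤ 0) (h₄ : b.cartanMatrix t p < 0) (h₅ : b.cartanMatrix p t < 0) :
    inversionNumber b (wordProd b [s, t, p, s, t, s]) = 6 := by
  have hv := injective_three hst hsp htp
  have h0 : inversionNumber b (wordProd b (([] : List (Fin 3)).map ![s, t, p])) = 0 := by simp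
  have h1 := inversionNumber_wordProd_snoc hv h0 0 0 (by
    simp [subCartanMatrix])
  have h2 := inversionNumber_wordProd_snoc hv h1 1 1 (by
    simp [subCartanMatrix])
  have h3 := inversionNumber_wordProd_snoc hv h2 2 2 (by
    simp [subCartanMatrix])
  have h4 := inversionNumber_wordProd_snoc hv h3 0 1 (by
    simp [subCartanMatrix]
    nlinarith)
  have h5 := inversionNumber_wordProd_snoc hv h4 1 2 (by
    simp [subCartanMatrix]
    nlinarith)
  -- The `p`-coordinate is `a_st a_tp - (a_st a_ts - 1) a_sp`; the hints give the signs of its two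
  -- terms.
  have h6 := inversionNumber_wordProd_snoc hv h5 0 2 (by
    simp [subCartanMatrix]
    nlinarith [mul_pos_of_neg_of_neg h₁ h₄, mul_nonneg (sub_nonneg.2 (Int.add_one_le_iff.2
      (mul_pos_of_neg_of_neg h₁ h₂))) (neg_nonneg.2 h₃)])
  exact h6

/-- For the last three letters the `p`-coordinate is `-a_sp` times an `s`-coordinate equal to `1`,
`-a_ts` and `a_st a_ts - 1` in turn; the multiple bond makes the last one positive. -/
lemma inversionNumber_sptsts (hst : s ≠ t) (hsp : s ≠ p) (htp : t ≠ p)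
    (h₂ : b.cartanMatrix t s < 0)
    (h₃ : b.cartanMatrix s p < 0) (h₄ : b.cartanMatrix t p = 0) (h₅ : b.cartanMatrix p t = 0)
    (h : 2 ≤ b.cartanMatrix s t * b.cartanMatrix t s) :
    inversionNumber b (wordProd b [s, p, t, s, t, s]) = 6 := by
  have hv := injective_three hst hsp htp
  have h0 : inversionNumber b (wordProd b (([] : List (Fin 3)).map ![s, t, p])) = 0 := by simp
  have h1 := inversionNumber_wordProd_snoc hv h0 0 0 (by
    simp [subCartanMatrix, h₄, h₅])
  have h2 := inversionNumber_wordProd_snoc hv h1 2 2 (by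
    simp [subCartanMatrix, h₄, h₅])
  have h3 := inversionNumber_wordProd_snoc hv h2 1 1 (by
    simp [subCartanMatrix, h₄, h₅])
  have h4 := inversionNumber_wordProd_snoc hv h3 0 2 (by
    simp [subCartanMatrix, h₄, h₅]
    nlinarith)
  have h5 := inversionNumber_wordProd_snoc hv h4 1 2 (by
    simp [subCartanMatrix, h₄, h₅]
    nlinarith)
  have h6 := inversionNumber_wordProd_snoc hv h5 0 2 (by
    simp [subCartanMatrix, h₄, h₅]
    nlinarith)
  exact h6

lemma inversionNumber_stpspts (hst : s ≠ t) (hsp : s ≠ p) (htp : t ≠ p)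
    (h₁ : b.cartanMatrix s t < 0) (h₂ : b.cartanMatrix t s < 0)
    (h₃ : b.cartanMatrix s p < 0) (h₄ : b.cartanMatrix t p = 0) (h₅ : b.cartanMatrix p t = 0)
    (h : 2 ≤ b.cartanMatrix s p * b.cartanMatrix p s) :
    inversionNumber b (wordProd b [s, t, p, s, p, t, s]) = 7 := by
  have hv := injective_three hst hsp htp
  have h0 : inversionNumber b (wordProd b (([] : List (Fin 3)).map ![s, t, p])) = 0 := by simp
  have h1 := inversionNumber_wordProd_snoc hv h0 0 0 (by
    simp [subCartanMatrix, h₄, h₅])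
  have h2 := inversionNumber_wordProd_snoc hv h1 1 1 (by
    simp [subCartanMatrix, h₄, h₅])
  have h3 := inversionNumber_wordProd_snoc hv h2 2 2 (by
    simp [subCartanMatrix, h₄, h₅])
  have h4 := inversionNumber_wordProd_snoc hv h3 0 2 (by
    simp [subCartanMatrix, h₄, h₅]
    nlinarith)
  have h5 := inversionNumber_wordProd_snoc hv h4 2 2 (by
    simp [subCartanMatrix, h₄, h₅]
    nlinarith)
  have h6 := inversionNumber_wordProd_snoc hv h5 1 2 (by
    simp [subCartanMatrix, h₄, h₅]
    nlinarith)
  -- The `p`-coordinate is `-a_sp (a_st a_ts + a_sp a_ps - 2)`.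
  have h7 := inversionNumber_wordProd_snoc hv h6 0 2 (by
    simp [subCartanMatrix, h₄, h₅]
    nlinarith [mul_pos_of_neg_of_neg h₁ h₂, mul_neg_of_pos_of_neg (a := b.cartanMatrix s t *
      b.cartanMatrix t s + b.cartanMatrix s p * b.cartanMatrix p s - 2)
      (by have := mul_pos_of_neg_of_neg h₁ h₂; lia) h₃])
  exact h7

lemma inversionNumber_stpqts (hst : s ≠ t) (hsp : s ≠ p) (htp : t ≠ p) (hsq : s ≠ q) (htq : t ≠ q)
    (hpq : p ≠ q) (h₁ : b.cartanMatrix s t = 0) (h₂ : b.cartanMatrix t s = 0)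
    (h₃ : b.cartanMatrix s p < 0) (h₄ : b.cartanMatrix t q < 0) (h₅ : b.cartanMatrix s q ≤ 0)
    (h₆ : b.cartanMatrix q p ≤ 0) :
    inversionNumber b (wordProd b [s, t, p, q, t, s]) = 6 := by
  have hv := injective_four hst hsp htp hsq htq hpq
  have h0 : inversionNumber b (wordProd b (([] : List (Fin 4)).map ![s, t, p, q])) = 0 := by simp
  have h1 := inversionNumber_wordProd_snoc hv h0 0 0 (by
    simp [subCartanMatrix, h₁, h₂])
  have h2 := inversionNumber_wordProd_snoc hv h1 1 1 (by
    simp [subCartanMatrix, h₁, h₂])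
  have h3 := inversionNumber_wordProd_snoc hv h2 2 2 (by
    simp [subCartanMatrix, h₁, h₂])
  have h4 := inversionNumber_wordProd_snoc hv h3 3 3 (by
    simp [subCartanMatrix, h₁, h₂])
  have h5 := inversionNumber_wordProd_snoc hv h4 1 3 (by
    simp [subCartanMatrix, h₁, h₂]
    nlinarith)
  have h6 := inversionNumber_wordProd_snoc hv h5 0 2 (by
    simp [subCartanMatrix, h₁, h₂]
    nlinarith)
  exact h6

/-- The element `s p t` fixes the sign by sending `α_s` to `α_s + α_t + α_p`; reflecting in `q` then
gives the `q`-coordinate `-(a_sq + a_pq) > 0`, which settles the last letter. -/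
lemma inversionNumber_stpqspts (hst : s ≠ t) (hsp : s ≠ p) (htp : t ≠ p) (hsq : s ≠ q) (htq : t ≠ q)
    (hpq : p ≠ q) (h₁ : b.cartanMatrix s t = -1) (h₂ : b.cartanMatrix t s = -1)
    (h₃ : b.cartanMatrix s p = -1) (h₄ : b.cartanMatrix p s = -1) (h₅ : b.cartanMatrix t p = 0)
    (h₆ : b.cartanMatrix p t = 0) (h₇ : b.cartanMatrix t q = 0) (h₈ : b.cartanMatrix q t = 0)
    (h₉ : b.cartanMatrix s q ≤ 0) (h₁₁ : b.cartanMatrix q p ≤ 0)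
    (h : b.cartanMatrix s q + b.cartanMatrix p q < 0) :
    inversionNumber b (wordProd b [s, t, p, q, s, p, t, s]) = 8 := by
  have hv := injective_four hst hsp htp hsq htq hpq
  have h0 : inversionNumber b (wordProd b (([] : List (Fin 4)).map ![s, t, p, q])) = 0 := by simp
  have h1 := inversionNumber_wordProd_snoc hv h0 0 0 (by
    simp [subCartanMatrix, h₁, h₂, h₃, h₄, h₅, h₆, h₇, h₈])
  have h2 := inversionNumber_wordProd_snoc hv h1 1 1 (by
    simp [subCartanMatrix, h₁, h₂, h₃, h₄, h₅, h₆, h₇, h₈])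
  have h3 := inversionNumber_wordProd_snoc hv h2 2 2 (by
    simp [subCartanMatrix, h₁, h₂, h₃, h₄, h₅, h₆, h₇, h₈])
  have h4 := inversionNumber_wordProd_snoc hv h3 3 3 (by
    simp [subCartanMatrix, h₁, h₂, h₃, h₄, h₅, h₆, h₇, h₈])
  have h5 := inversionNumber_wordProd_snoc hv h4 0 2 (by
    simp [subCartanMatrix, h₁, h₂, h₃, h₄, h₅, h₆, h₇, h₈]
    nlinarith)
  have h6 := inversionNumber_wordProd_snoc hv h5 2 3 (by
    simp [subCartanMatrix, h₁, h₂, h₃, h₄, h₅, h₆, h₇, h₈]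
    nlinarith)
  have h7 := inversionNumber_wordProd_snoc hv h6 1 2 (by
    simp [subCartanMatrix, h₁, h₂, h₃, h₄, h₅, h₆, h₇, h₈]
    nlinarith)
  have h8 := inversionNumber_wordProd_snoc hv h7 0 3 (by
    simp [subCartanMatrix, h₁, h₂, h₃, h₄, h₅, h₆, h₇, h₈]
    nlinarith)
  exact h8

variable [P.IsRootSystem]

lemma bruhatLE_one : BruhatLE b (1 : P.weylGroup) (longestElement b * 1) :=
  bruhatLE_longestElement_mul b (l := []) (l' := []) (List.Sublist.refl _) (by simp) (by simp)

lemma bruhatLE_single (hst : s ≠ t) (h : b.cartanMatrix s t ≠ 0) :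
    BruhatLE b (wordProd b [s]) (longestElement b * wordProd b [s]) :=
  bruhatLE_longestElement_mul b (l := [s, t]) (l' := [s]) (by simp)
    (inversionNumber_wordProd_single s)
    (inversionNumber_sts hst (lt_of_le_of_ne (b.cartanMatrix_le_zero_of_ne s t hst) h))

/-- If no component of the Dynkin diagram has type `A₁`, `A₂`, `A₃` or `B₂` then `w ≤ w₀ w` for all
`w` of length two. -/
lemma bruhatLE_pair
    (hA₁ : ∀ s : b.support, ∃ t, s ≠ t ∧ b.cartanMatrix s t ≠ 0)
    (hA₂B₂ : ∀ s t : b.support, s ≠ t → b.cartanMatrix s t < 0 → b.cartanMatrix t s < 0 →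
      b.cartanMatrix s t * b.cartanMatrix t s ≤ 2 →
      ∃ p, s ≠ p ∧ t ≠ p ∧ (b.cartanMatrix s p ≠ 0 ∨ b.cartanMatrix t p ≠ 0))
    (hA₃ : ∀ s t p : b.support, s ≠ t → s ≠ p → t ≠ p → b.cartanMatrix s t = -1 →
      b.cartanMatrix t s = -1 → b.cartanMatrix s p = -1 → b.cartanMatrix p s = -1 →
      b.cartanMatrix t p = 0 → b.cartanMatrix p t = 0 → ∃ q, s ≠ q ∧ t ≠ q ∧ p ≠ q ∧
        (b.cartanMatrix s q ≠ 0 ∨ b.cartanMatrix t q ≠ 0 ∨ b.cartanMatrix p q ≠ 0))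
    (hst : s ≠ t) :
    BruhatLE b (wordProd b [s, t]) (longestElement b * wordProd b [s, t]) := by
  have hle (i j : b.support) (h : i ≠ j) : b.cartanMatrix i j ≤ 0 :=
    b.cartanMatrix_le_zero_of_ne i j h
  have hlt (i j : b.support) (h : i ≠ j) (h' : b.cartanMatrix i j ≠ 0) :
      b.cartanMatrix i j < 0 := lt_of_le_of_ne (hle i j h) h'
  have hsymm (i j : b.support) : b.cartanMatrix i j = 0 ↔ b.cartanMatrix j i = 0 :=
    b.cartanMatrix_apply_eq_zero_iff_symm
  have key (l : List b.support) (hsub : [s, t].Sublist l)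
      (hl : inversionNumber b (wordProd b (l ++ [t, s])) = l.length + 2) :
      BruhatLE b (wordProd b [s, t]) (longestElement b * wordProd b [s, t]) :=
    bruhatLE_longestElement_mul b hsub (inversionNumber_wordProd_pair hst) hl
  -- Commuting letters: a common neighbour `p`, or else a separate neighbour for each.
  by_cases h₀ : b.cartanMatrix s t = 0
  · have h₀' := (hsymm s t).1 h₀
    obtain ⟨p, hsp, hsp'⟩ := hA₁ s
    have htp : t ≠ p := by rintro rfl; exact hsp' h₀
    by_cases htp' : b.cartanMatrix t p = 0
    · obtain ⟨q, htq, htq'⟩ := hA₁ t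
      have hsq : s ≠ q := by rintro rfl; exact htq' h₀'
      have hpq : p ≠ q := by rintro rfl; exact htq' htp'
      exact key [s, t, p, q] (by simp) (inversionNumber_stpqts hst hsp htp hsq htq hpq h₀ h₀'
        (hlt _ _ hsp hsp') (hlt _ _ htq htq') (hle _ _ hsq) (hle _ _ hpq.symm))
    · exact key [s, t, p] (by simp) (inversionNumber_stpts hst hsp htp h₀ h₀'
        (hlt _ _ hsp hsp') (hlt _ _ htp htp'))
  have h₁ := hlt s t hst h₀
  have h₂ := hlt t s hst.symm (fun h => h₀ ((hsymm s t).2 h))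
  -- Adjacent letters. As `st ≠ ts`, the roles differ: a further neighbour of `t` settles the matter
  -- at once, and afterwards `t` is joined to `s` only.
  by_cases hp : ∃ p, s ≠ p ∧ t ≠ p ∧ b.cartanMatrix t p ≠ 0
  · obtain ⟨p, hsp, htp, htp'⟩ := hp
    exact key [s, t, p, s] (by simp) (inversionNumber_stpsts hst hsp htp h₁ h₂ (hle _ _ hsp)
      (hlt _ _ htp htp') (hlt _ _ htp.symm (fun h => htp' ((hsymm _ _).2 h))))
  have ht (p : b.support) (hsp : s ≠ p) (htp : t ≠ p) : b.cartanMatrix t p = 0 := by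
    by_contra h; exact hp ⟨p, hsp, htp, h⟩
  by_cases h3 : 3 ≤ b.cartanMatrix s t * b.cartanMatrix t s
  · exact key [s, t, s] (by simp) (inversionNumber_ststs hst h₁ h3)
  obtain ⟨p, hsp, htp, hsp'⟩ := hA₂B₂ s t hst h₁ h₂ (by lia)
  have h₄ := ht p hsp htp
  have h₅ := (hsymm _ _).1 h₄
  replace hsp' := hlt s p hsp (hsp'.resolve_right (fun h => h h₄))
  have hps' := hlt p s hsp.symm (fun h => hsp'.ne ((hsymm _ _).2 h))
  by_cases h2 : 2 ≤ b.cartanMatrix s t * b.cartanMatrix t s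
  · exact key [s, p, t, s] (by simp) (inversionNumber_sptsts hst hsp htp h₂ hsp' h₄ h₅ h2)
  by_cases h2' : 2 ≤ b.cartanMatrix s p * b.cartanMatrix p s
  · exact key [s, t, p, s, p] (by simp)
      (inversionNumber_stpspts hst hsp htp h₁ h₂ hsp' h₄ h₅ h2')
  have hone (x y : ℤ) (hx : x < 0) (hy : y < 0) (hxy : ¬ 2 ≤ x * y) : x = -1 := by
    by_contra h
    have : x ≤ -2 := by lia
    nlinarith
  have e₁ := hone _ _ h₁ h₂ h2
  have e₂ := hone _ _ h₂ h₁ (by rwa [mul_comm])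
  have e₃ := hone _ _ hsp' hps' h2'
  have e₄ := hone _ _ hps' hsp' (by rwa [mul_comm])
  -- All bonds are now simple and `t - s - p` has type `A₃`, so a fourth node is needed; it cannot
  -- be attached to `t`.
  obtain ⟨q, hsq, htq, hpq, hq⟩ := hA₃ s t p hst hsp htp e₁ e₂ e₃ e₄ h₄ h₅
  have h₇ := ht q hsq htq
  have hsq' := hle s q hsq
  have hpq' := hle p q hpq
  exact key [s, t, p, q, s, p] (by simp) (inversionNumber_stpqspts hst hsp htp hsq htq hpq e₁ e₂
    e₃ e₄ h₄ h₅ h₇ ((hsymm _ _).1 h₇) hsq' (hle _ _ hpq.symm) (by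
      rcases hq with h | h | h
      · lia
      · exact absurd h₇ h
      · lia))

end ReducedWords

end

/-! ### The Cartan subalgebra and roots of an ideal. -/

section

open LieAlgebra LieAlgebra.IsKilling LieModule Module

section IdealRoots

variable {K L : Type*} [Field K] [CharZero K] [LieRing L] [LieAlgebra K L]
  [FiniteDimensional K L] [IsKilling K L] {H : LieSubalgebra K L} [H.IsCartanSubalgebra]
  [IsTriangularizable K H L]

omit [CharZero K] in
lemma coroot_mem_of_mem_rootSet {I : LieIdeal K L} {α : H.root} (hα : α ∈ I.rootSet) :
    (coroot (α : Weight K H L) : L) ∈ I :=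
  I.corootSubmodule_le hα (coe_coroot_mem_corootSubmodule _)

/-- The ideal is spanned by its part in `H` and its root spaces; `H` is abelian, and roots of the
ideal vanish on coroots of roots outside it. -/
lemma lie_coroot_eq_zero_of_notMem_rootSet {I : LieIdeal K L} {β : H.root} (hβ : β ∉ I.rootSet)
    {x : L} (hx : x ∈ I) : ⁅coroot (β : Weight K H L), x⁆ = 0 := by
  have h : (I.restr H).toSubmodule ≤
      LinearMap.ker (toEnd K H L (coroot (β : Weight K H L))) := by
    rw [lieIdeal_eq_inf_cartan_sup_biSup_rootSpace, LieSubmodule.sup_toSubmodule]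
    refine sup_le ?_ ?_
    · rintro y ⟨-, hy⟩
      have := congrArg Subtype.val (LieModule.IsTrivial.trivial (coroot (β : Weight K H L))
        (⟨y, hy⟩ : H))
      simpa using this
    · simp only [LieSubmodule.iSup_toSubmodule]
      refine iSup₂_le fun α hα y hy => ?_
      rw [LinearMap.mem_ker, toEnd_apply_apply]
      refine (lie_eq_smul_of_mem_rootSpace hy _).trans ?_
      have h0 : (α : Weight K H L) (coroot (β : Weight K H L)) = 0 :=
        I.rootSet_apply_coroot_eq_zero_of_notMem_rootSet hα hβ
      rw [h0, zero_smul]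
  exact h hx

lemma span_coroot_eq_top :
    Submodule.span K (Set.range fun α : H.root => coroot (α : Weight K H L)) = ⊤ :=
  RootPairing.IsRootSystem.span_coroot_eq_top (P := rootSystem H)

variable (H) in
/-- The intersection of an ideal with a Cartan subalgebra, as a subalgebra of the ideal. -/
def idealCartan (I : LieIdeal K L) : LieSubalgebra K I := H.comap I.incl

omit [CharZero K] [FiniteDimensional K L] [IsKilling K L] [H.IsCartanSubalgebra]
  [IsTriangularizable K H L] in
lemma mem_idealCartan {I : LieIdeal K L} {x : I} : x ∈ idealCartan H I ↔ (x : L) ∈ H := Iff.rfl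

variable (H) in
/-- The inclusion of `idealCartan H I` in the Cartan subalgebra. -/
def idealCartanIncl (I : LieIdeal K L) : idealCartan H I →ₗ[K] H where
  toFun x := ⟨((x : I) : L), x.2⟩
  map_add' _ _ := rfl
  map_smul' _ _ := rfl

instance isLieAbelian_idealCartan (I : LieIdeal K L) : IsLieAbelian (idealCartan H I) :=
  ⟨fun x y => by
    have h : ((⁅idealCartanIncl H I x, idealCartanIncl H I y⁆ : H) : L) = 0 :=
      congrArg Subtype.val
        (LieModule.IsTrivial.trivial (idealCartanIncl H I x) (idealCartanIncl H I y))
    exact Subtype.ext (Subtype.ext h)⟩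

/-- The coroot of a root of an ideal, in the Cartan subalgebra of the ideal. -/
def idealCoroot (I : LieIdeal K L) {α : H.root} (hα : α ∈ I.rootSet) : idealCartan H I :=
  ⟨⟨coroot (α : Weight K H L), coroot_mem_of_mem_rootSet hα⟩, (coroot (α : Weight K H L)).2⟩

/-- Coroots span `H`: those of the ideal lie in the intersection and the others commute with the
ideal. An element normalizing the intersection thus normalizes `H`, hence lies in it. -/
instance isCartanSubalgebra_idealCartan (I : LieIdeal K L) :
    (idealCartan H I).IsCartanSubalgebra where
  nilpotent := inferInstance
  self_normalizing := by
    refine le_antisymm (fun x hx => ?_) (LieSubalgebra.le_normalizer _)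
    rw [LieSubalgebra.mem_normalizer_iff] at hx
    rw [mem_idealCartan, ← LieSubalgebra.IsCartanSubalgebra.self_normalizing (H := H),
      LieSubalgebra.mem_normalizer_iff]
    intro y hy
    have key : (⟨y, hy⟩ : H) ∈ (H.toSubmodule.comap (ad K L (x : L))).comap H.toSubmodule.subtype := by
      have : (⟨y, hy⟩ : H) ∈ Submodule.span K
          (Set.range fun α : H.root => coroot (α : Weight K H L)) := by
        rw [span_coroot_eq_top]; trivial
      refine Submodule.span_le.2 ?_ this
      rintro _ ⟨α, rfl⟩
      change ⁅(x : L), (coroot (α : Weight K H L) : L)⁆ ∈ H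
      by_cases hα : α ∈ I.rootSet
      · exact hx _ (idealCoroot I hα).2
      · have := lie_coroot_eq_zero_of_notMem_rootSet hα x.2
        rw [← lie_skew]
        change -⁅coroot (α : Weight K H L), (x : L)⁆ ∈ H
        rw [this, neg_zero]
        exact H.zero_mem
    exact key

lemma mk_mem_rootSpace_idealCartan {I : LieIdeal K L} {χ : H → K} {x : L} (hx : x ∈ rootSpace H χ)
    (hxI : x ∈ I) : (⟨x, hxI⟩ : I) ∈ rootSpace (idealCartan H I) (χ ∘ idealCartanIncl H I) := by
  apply weightSpace_le_genWeightSpace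
  rw [mem_weightSpace]
  intro h
  exact Subtype.ext (lie_eq_smul_of_mem_rootSpace hx (idealCartanIncl H I h))

variable {I : LieIdeal K L} [IsKilling K I] [IsTriangularizable K (idealCartan H I) I]

/-- The `sl₂`-triple of `α` lies in the ideal and is also a triple for the restricted root, so the
same `h` is the coroot of both. -/
lemma exists_root_idealCartan {α : H.root} (hα : α ∈ I.rootSet) :
    ∃ α' : (idealCartan H I).root,
      (α' : Weight K (idealCartan H I) I).toLinear =
        (α : Weight K H L).toLinear ∘ₗ idealCartanIncl H I ∧
      idealCartanIncl H I (coroot (α' : Weight K (idealCartan H I) I)) =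
        coroot (α : Weight K H L) := by
  have hα₀ : (α : Weight K H L).IsNonZero := H.isNonZero_coe_root α
  obtain ⟨h, e, f, ht, he, hf⟩ := exists_isSl2Triple_of_weight_isNonZero hα₀
  have heI : e ∈ I := hα he
  have hfI : f ∈ I := by
    refine I.rootSpace_le_of_apply_coroot_ne_zero (γ := -((α : Weight K H L) : H → K)) hα ?_ hf
    simp [root_apply_coroot hα₀]
  have hhI : h ∈ I := by rw [← ht.lie_e_f]; exact lie_mem_left K L I _ _ heI
  have he' := mk_mem_rootSpace_idealCartan he heI
  have hf' := mk_mem_rootSpace_idealCartan hf hfI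
  have hne : rootSpace (idealCartan H I) ((α : Weight K H L) ∘ idealCartanIncl H I) ≠ ⊥ := by
    intro hbot
    exact ht.e_ne_zero (congrArg Subtype.val ((LieSubmodule.mem_bot _).1 (hbot.le he')))
  let α' : Weight K (idealCartan H I) I := ⟨(α : Weight K H L) ∘ idealCartanIncl H I, hne⟩
  have hα' : α'.IsNonZero := by
    intro h0
    have h1 : α' (idealCoroot I hα) = 0 := by rw [h0.eq]; rfl
    change (α : Weight K H L) (coroot (α : Weight K H L)) = 0 at h1
    rw [root_apply_coroot hα₀] at h1
    exact two_ne_zero h1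
  refine ⟨⟨α', by simpa using hα'⟩, by ext; rfl, ?_⟩
  have ht' : IsSl2Triple (⟨h, hhI⟩ : I) ⟨e, heI⟩ ⟨f, hfI⟩ :=
    ⟨fun h0 => ht.h_ne_zero (congrArg Subtype.val h0), Subtype.ext ht.lie_e_f,
      Subtype.ext ht.lie_h_e_nsmul, Subtype.ext ht.lie_h_f_nsmul⟩
  have h1 := ht'.h_eq_coroot hα' he' hf'
  have h2 := ht.h_eq_coroot hα₀ he hf
  apply Subtype.ext
  rw [← h2]
  exact (congrArg Subtype.val h1).symm

/-- A root vector `x` for the smaller Cartan subalgebra is an eigenvector of every coroot, hence of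
`H`. Its root space for `H` is a line, so `x` lying in the ideal puts the whole root space there. -/
lemma exists_mem_rootSet_of_root_idealCartan (γ : (idealCartan H I).root) :
    ∃ α : H.root, α ∈ I.rootSet ∧ (γ : Weight K (idealCartan H I) I).toLinear =
        (α : Weight K H L).toLinear ∘ₗ idealCartanIncl H I := by
  obtain ⟨x, hx, hx0⟩ := (γ : Weight K (idealCartan H I) I).exists_ne_zero
  have hxL : (x : L) ≠ 0 := fun h => hx0 (Subtype.ext h)
  have hex (h : H) : ∃ c : K, ⁅h, (x : L)⁆ = c • (x : L) := by
    have : h ∈ Submodule.span K (Set.range fun α : H.root => coroot (α : Weight K H L)) := by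
      rw [span_coroot_eq_top]; trivial
    induction this using Submodule.span_induction with
    | mem y hy =>
      obtain ⟨α, rfl⟩ := hy
      by_cases hα : α ∈ I.rootSet
      · exact ⟨_, congrArg Subtype.val (lie_eq_smul_of_mem_rootSpace hx (idealCoroot I hα))⟩
      · exact ⟨0, by rw [zero_smul]; exact lie_coroot_eq_zero_of_notMem_rootSet hα x.2⟩
    | zero => exact ⟨0, by simp⟩
    | add y z _ _ hy hz =>
      obtain ⟨c, hc⟩ := hy
      obtain ⟨d, hd⟩ := hz
      exact ⟨c + d, by rw [add_lie, hc, hd, add_smul]⟩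
    | smul a y _ hy =>
      obtain ⟨c, hc⟩ := hy
      exact ⟨a * c, by rw [smul_lie, hc, mul_smul]⟩
  choose χ hχ using hex
  have hxχ : (x : L) ∈ rootSpace H χ := by
    apply weightSpace_le_genWeightSpace
    rw [mem_weightSpace]
    exact hχ
  let α : Weight K H L := ⟨χ, fun h => hxL ((LieSubmodule.mem_bot _).1 (h.le hxχ))⟩
  have hγ (h : idealCartan H I) : (γ : Weight K (idealCartan H I) I) h =
      χ (idealCartanIncl H I h) := by
    have h1 : ⁅idealCartanIncl H I h, (x : L)⁆ = (γ : Weight K (idealCartan H I) I) h • (x : L) :=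
      congrArg Subtype.val (lie_eq_smul_of_mem_rootSpace hx h)
    rw [hχ] at h1
    exact (smul_left_injective K hxL h1).symm
  have hα : α.IsNonZero := by
    intro h0
    apply (idealCartan H I).isNonZero_coe_root γ
    ext h
    rw [hγ]
    exact congrFun h0 _
  refine ⟨⟨α, by simpa using hα⟩, ?_, by ext h; exact hγ h⟩
  rw [LieIdeal.mem_rootSet]
  intro y hy
  obtain ⟨c, hc⟩ := (finrank_eq_one_iff_of_nonzero' (⟨(x : L), hxχ⟩ : rootSpace H α)
    (fun h => hxL (congrArg Subtype.val h))).mp (finrank_rootSpace_eq_one α hα) ⟨y, hy⟩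
  have : y = c • (x : L) := (congrArg Subtype.val hc).symm
  rw [this]
  exact I.smul_mem c x.2

end IdealRoots

end

/-! ### From Dynkin components to simple ideals. -/

section

open LieAlgebra LieAlgebra.IsKilling LieModule Module

section InvariantSubmodules

variable {ι K M N : Type*} [Field K] [CharZero K] [Finite ι] [AddCommGroup M] [Module K M]
  [AddCommGroup N] [Module K N] {P : RootPairing ι K M N} [P.IsCrystallographic] [P.IsReduced]
  {b : P.Base} {n : ℕ} {v : Fin n → b.support}

variable (P) in
/-- The span of a family of roots. -/
def rootFamilySpan {κ : Type*} (v : κ → ι) : Submodule K M :=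
  Submodule.span K (Set.range fun i => P.root (v i))

omit [CharZero K] [Finite ι] [P.IsCrystallographic] [P.IsReduced] in
lemma root_mem_rootFamilySpan_iff (j : b.support) :
    P.root j ∈ rootFamilySpan P (fun i => (v i : ι)) ↔ j ∈ Set.range v := by
  have h : (Set.range fun i => P.root (v i : ι)) =
      (fun j : b.support => P.root (j : ι)) '' Set.range v := by
    rw [← Set.range_comp]; rfl
  constructor
  · intro hj
    by_contra hc
    rw [rootFamilySpan, h] at hj
    exact b.linearIndepOn_root.linearIndependent.notMem_span_image hc hj
  · rintro ⟨i, rfl⟩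
    exact Submodule.subset_span ⟨i, rfl⟩

/-- Simple reflections suffice: those in the family subtract a multiple of a spanning root, and the
others fix the span pointwise. -/
lemma rootFamilySpan_mem_invtRootSubmodule
    (hclosed : ∀ i, ∀ j ∉ Set.range v, b.cartanMatrix (v i) j = 0) :
    rootFamilySpan P (fun i => (v i : ι)) ∈ P.invtRootSubmodule := by
  rw [RootPairing.mem_invtRootSubmodule_iff, ← b.forall_mem_support_invtSubmodule_iff]
  refine fun k hk => (Module.End.mem_invtSubmodule _).mpr fun x hx => ?_
  rw [Submodule.mem_comap, LinearEquiv.coe_coe, RootPairing.reflection_apply]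
  by_cases hkv : (⟨k, hk⟩ : b.support) ∈ Set.range v
  · exact Submodule.sub_mem _ hx (Submodule.smul_mem _ _
      ((root_mem_rootFamilySpan_iff ⟨k, hk⟩).2 hkv))
  · have hle : rootFamilySpan P (fun i => (v i : ι)) ≤ LinearMap.ker (P.coroot' k) := by
      refine Submodule.span_le.2 ?_
      rintro _ ⟨i, rfl⟩
      have := b.cartanMatrix_apply_eq_zero_iff_pairing.1 (hclosed i ⟨k, hk⟩ hkv)
      simpa using this
    rw [LinearMap.mem_ker.1 (hle hx), zero_smul, sub_zero]
    exact hx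

omit [Finite ι] [P.IsReduced] in
lemma root_mem_of_cartanMatrix_ne_zero (q : P.invtRootSubmodule) {i j : b.support}
    (hi : P.root i ∈ (q : Submodule K M)) (hij : b.cartanMatrix i j ≠ 0) :
    P.root j ∈ (q : Submodule K M) := by
  by_contra hj
  have := RootPairing.invtRootSubmodule.le_ker_coroot' q hj hi
  rw [LinearMap.mem_ker, P.root_coroot'_eq_pairing] at this
  exact hij (b.cartanMatrix_apply_eq_zero_iff_pairing.2 this)

/-- The span of a connected component of the Dynkin diagram is a minimal invariant submodule. -/
lemma isAtom_rootFamilySpan [P.IsRootSystem] [NeZero n]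
    (hclosed : ∀ i, ∀ j ∉ Set.range v, b.cartanMatrix (v i) j = 0)
    (hconn : ∀ i j, Relation.ReflTransGen (fun k l => b.cartanMatrix (v k) (v l) ≠ 0) i j) :
    IsAtom (⟨_, rootFamilySpan_mem_invtRootSubmodule hclosed⟩ : P.invtRootSubmodule) := by
  rw [isAtom_iff_le_of_ge]
  constructor
  · rw [Ne, RootPairing.invtRootSubmodule.eq_bot_iff]
    exact fun h => h (v 0) ((root_mem_rootFamilySpan_iff (v 0)).2 ⟨0, rfl⟩)
  · intro q hq hle
    rw [Ne, RootPairing.invtRootSubmodule.eq_bot_iff] at hq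
    push Not at hq
    obtain ⟨i, hi⟩ := hq
    -- Some simple root pairs nontrivially with the root found in `q`, hence lies in `q`;
    -- connectedness then spreads membership over the component.
    obtain ⟨j, hj, hij⟩ := b.exists_mem_support_pos_pairingIn_ne_zero i
    have hjq : P.root j ∈ (q : Submodule K M) := by
      by_contra hjq
      have := RootPairing.invtRootSubmodule.le_ker_coroot' q hjq hi
      rw [LinearMap.mem_ker, P.root_coroot'_eq_pairing] at this
      apply hij
      rw [P.pairingIn_eq_zero_iff]
      apply FaithfulSMul.algebraMap_injective ℤ K
      rw [RootPairing.algebraMap_pairingIn, this, map_zero]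
    obtain ⟨k, hk⟩ := (root_mem_rootFamilySpan_iff ⟨j, hj⟩).1 (hle hjq)
    refine Submodule.span_le.2 ?_
    rintro _ ⟨l, rfl⟩
    have hstart : P.root (v k) ∈ (q : Submodule K M) := by rw [hk]; exact hjq
    change P.root (v l) ∈ (q : Submodule K M)
    induction hconn k l with
    | refl => exact hstart
    | tail _ h ih => exact root_mem_of_cartanMatrix_ne_zero q ih h

end InvariantSubmodules

section Component

variable {L : Type*} [LieRing L] [LieAlgebra ℂ L] [FiniteDimensional ℂ L] [IsKilling ℂ L]
  {H : LieSubalgebra ℂ L} [H.IsCartanSubalgebra] {b : (rootSystem H).Base}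
  {n : ℕ} [NeZero n] {v : Fin n → b.support}

/-- A connected component of the Dynkin diagram gives a simple ideal whose Cartan matrix is that
of the component. -/
theorem hasFactorOfType_of_component {C : Matrix (Fin n) (Fin n) ℤ} (hv : Function.Injective v)
    (hC : ∀ i j, b.cartanMatrix (v i) (v j) = C i j)
    (hclosed : ∀ i, ∀ j ∉ Set.range v, b.cartanMatrix (v i) j = 0)
    (hconn : ∀ i j, Relation.ReflTransGen (fun k l => C k l ≠ 0) i j) :
    HasFactorOfType L C := by
  have hq := rootFamilySpan_mem_invtRootSubmodule hclosed
  have hq' := (rootSystem H).mem_invtRootSubmodule_iff.1 hq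
  let q : (rootSystem H).invtRootSubmodule := ⟨_, hq⟩
  let I : LieIdeal ℂ L := invtSubmoduleToLieIdeal q.1 hq'
  have hatom : IsAtom I := by
    rw [← (lieIdealOrderIso H).isAtom_iff]
    have : lieIdealOrderIso H I = q := (lieIdealOrderIso H).apply_symm_apply q
    rw [this]
    exact isAtom_rootFamilySpan hclosed (by simpa only [hC] using hconn)
  have hsimple : IsSimple ℂ I := IsSemisimple.isSimple_of_isAtom I hatom
  refine ⟨I, hsimple, idealCartan H I, inferInstance, ?_⟩
  have hroot (α : H.root) : α ∈ I.rootSet ↔ (rootSystem H).root α ∈ q.1 :=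
    mem_rootSet_invtSubmoduleToLieIdeal q.1 hq'
  have hvI (i : Fin n) : (v i : H.root) ∈ I.rootSet :=
    (hroot _).2 ((root_mem_rootFamilySpan_iff (v i)).2 ⟨i, rfl⟩)
  choose w hw hw' using fun i => exists_root_idealCartan (hvI i)
  let r : Dual ℂ H →ₗ[ℂ] Dual ℂ (idealCartan H I) := (idealCartanIncl H I).dualMap
  have hrw (i : Fin n) : (rootSystem (idealCartan H I)).root (w i) =
      r ((rootSystem H).root (v i)) := hw i
  -- Restriction is injective on `q`: coroots of the ideal lie in the smaller Cartan subalgebra, and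
  -- the other coroots vanish on `q`.
  have hr0 {x : Dual ℂ H} (hx : x ∈ q.1) (hrx : r x = 0) : x = 0 := by
    rw [(rootSystem H).eq_zero_iff_forall_coroot'_eq_zero]
    intro i
    by_cases hi : i ∈ I.rootSet
    · exact LinearMap.congr_fun hrx (idealCoroot I hi)
    · rw [hroot] at hi
      exact RootPairing.invtRootSubmodule.le_ker_coroot' q hi hx
  have hli : LinearIndependent ℂ (fun i => (rootSystem (idealCartan H I)).root (w i)) := by
    have h1 : LinearIndependent ℂ (fun i => (rootSystem H).root (v i)) :=
      b.linearIndepOn_root.linearIndependent.comp v hv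
    simp only [hrw]
    refine h1.map_injOn r ?_
    intro x hx y hy hxy
    refine sub_eq_zero.1 (hr0 (q.1.sub_mem hx hy) ?_)
    rw [map_sub, hxy, sub_self]
  have hwinj : Function.Injective w := fun i j hij => hli.injective (by simp only [hij])
  -- Simple roots outside the component restrict to zero, so nonnegative combinations restrict to
  -- nonnegative combinations of the `w i`; hence these form a base.
  have hmem {x : Dual ℂ H} (hx : x ∈ AddSubmonoid.closure ((rootSystem H).root '' b.support)) :
      r x ∈ AddSubmonoid.closure ((rootSystem (idealCartan H I)).root '' Set.range w) := by
    have hle : AddSubmonoid.closure ((rootSystem H).root '' b.support) ≤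
        (AddSubmonoid.closure ((rootSystem (idealCartan H I)).root '' Set.range w)).comap
          r.toAddMonoidHom := by
      rw [AddSubmonoid.closure_le]
      rintro _ ⟨j, hj, rfl⟩
      by_cases hjv : (⟨j, hj⟩ : b.support) ∈ Set.range v
      · obtain ⟨i, hi⟩ := hjv
        refine AddSubmonoid.subset_closure ⟨w i, ⟨i, rfl⟩, ?_⟩
        rw [hrw, hi]
        rfl
      · have hjI : j ∉ I.rootSet := by
          rwa [hroot, ← root_mem_rootFamilySpan_iff ⟨j, hj⟩] at *
        have : r ((rootSystem H).root j) = 0 := by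
          ext h
          exact I.root_apply_eq_zero_of_notMem_rootSet (h : I).2 hjI
        rw [SetLike.mem_coe, AddSubmonoid.mem_comap]
        exact this.symm ▸ AddSubmonoid.zero_mem _
    exact hle hx
  have hsp (γ : (idealCartan H I).root) :
      (rootSystem (idealCartan H I)).root γ ∈
        AddSubmonoid.closure ((rootSystem (idealCartan H I)).root '' Set.range w) ∨
      -(rootSystem (idealCartan H I)).root γ ∈
        AddSubmonoid.closure ((rootSystem (idealCartan H I)).root '' Set.range w) := by
    obtain ⟨α, -, hγ⟩ := exists_mem_rootSet_of_root_idealCartan γ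
    have hγ' : (rootSystem (idealCartan H I)).root γ = r ((rootSystem H).root α) := hγ
    rw [hγ', ← map_neg]
    exact (b.root_mem_or_neg_mem α).imp hmem hmem
  let b' : (rootSystem (idealCartan H I)).Base :=
    RootPairing.Base.mk' _ (Set.range w) ((linearIndepOn_range_iff hwinj _).2 hli) hsp
  have hsupp (γ : (idealCartan H I).root) : γ ∈ b'.support ↔ γ ∈ Set.range w :=
    Set.Finite.mem_toFinset _
  let f₀ : Fin n → b'.support := fun i => ⟨w i, (hsupp _).2 ⟨i, rfl⟩⟩
  have hf₀ : Function.Bijective f₀ := by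
    refine ⟨fun i j hij => hwinj (congrArg Subtype.val hij), fun γ => ?_⟩
    obtain ⟨i, hi⟩ := (hsupp γ).1 γ.2
    exact ⟨i, Subtype.ext hi⟩
  let f : Fin n ≃ b'.support := Equiv.ofBijective f₀ hf₀
  refine ⟨b', f.symm, fun i j => ?_⟩
  obtain ⟨i, rfl⟩ := f.surjective i
  obtain ⟨j, rfl⟩ := f.surjective j
  rw [f.symm_apply_apply, f.symm_apply_apply, ← hC]
  apply FaithfulSMul.algebraMap_injective ℤ ℂ
  rw [RootPairing.Base.algebraMap_cartanMatrixIn_apply,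
    RootPairing.Base.algebraMap_cartanMatrixIn_apply]
  change (rootSystem (idealCartan H I)).pairing (w i) (w j) = _
  rw [rootSystem_pairing_apply, rootSystem_pairing_apply, ← hw' j]
  exact LinearMap.congr_fun (hw i) _

end Component

end

/-! ### Excluding small components, and the membership statements. -/

section

open LieAlgebra LieAlgebra.IsKilling

section SmallComponents

variable {L : Type*} [LieRing L] [LieAlgebra ℂ L] [FiniteDimensional ℂ L] [IsKilling ℂ L]
  {H : LieSubalgebra ℂ L} [H.IsCartanSubalgebra] {b : (rootSystem H).Base}

lemma exists_cartanMatrix_ne_zero (hA₁ : ¬ HasFactorOfType L (CartanMatrix.A 1)) (s : b.support) :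
    ∃ t, s ≠ t ∧ b.cartanMatrix s t ≠ 0 := by
  by_contra! hc
  refine hA₁ (hasFactorOfType_of_component (b := b) (v := ![s]) ?_ ?_ ?_ ?_)
  · exact Function.injective_of_subsingleton _
  · intro i j
    fin_cases i; fin_cases j
    simp [CartanMatrix.A]
  · intro i j hj
    fin_cases i
    exact hc j (by rintro rfl; simp at hj)
  · intro i j
    rw [Subsingleton.elim i j]

lemma cartanMatrix_pair_eq_zero {s t : b.support}
    (hc : ∀ p, s ≠ p → t ≠ p → b.cartanMatrix s p = 0 ∧ b.cartanMatrix t p = 0) (i : Fin 2)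
    (j : b.support) (hj : j ∉ Set.range ![s, t]) : b.cartanMatrix (![s, t] i) j = 0 := by
  have h := hc j (by rintro rfl; exact hj ⟨0, rfl⟩) (by rintro rfl; exact hj ⟨1, rfl⟩)
  fin_cases i
  · exact h.1
  · exact h.2

lemma reflTransGen_two {C : Matrix (Fin 2) (Fin 2) ℤ} (h : C 0 1 ≠ 0) (h' : C 1 0 ≠ 0)
    (i j : Fin 2) : Relation.ReflTransGen (fun k l => C k l ≠ 0) i j := by
  fin_cases i <;> fin_cases j
  · exact .refl
  · exact .single h
  · exact .single h'
  · exact .refl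

lemma exists_cartanMatrix_ne_zero_of_pair (hA₂ : ¬ HasFactorOfType L (CartanMatrix.A 2))
    (hB₂ : ¬ HasFactorOfType L (CartanMatrix.B 2)) {s t : b.support} (hst : s ≠ t)
    (h₁ : b.cartanMatrix s t < 0) (h₂ : b.cartanMatrix t s < 0)
    (h : b.cartanMatrix s t * b.cartanMatrix t s ≤ 2) :
    ∃ p, s ≠ p ∧ t ≠ p ∧ (b.cartanMatrix s p ≠ 0 ∨ b.cartanMatrix t p ≠ 0) := by
  by_contra! hc
  have e₁ : -2 ≤ b.cartanMatrix s t := by nlinarith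
  have e₂ : -2 ≤ b.cartanMatrix t s := by nlinarith
  have hcases : (b.cartanMatrix s t = -1 ∧ b.cartanMatrix t s = -1) ∨
      (b.cartanMatrix s t = -2 ∧ b.cartanMatrix t s = -1) ∨
      (b.cartanMatrix s t = -1 ∧ b.cartanMatrix t s = -2) := by
    generalize b.cartanMatrix s t = x at *
    generalize b.cartanMatrix t s = y at *
    interval_cases x <;> interval_cases y <;> simp_all
  rcases hcases with ⟨hx, hy⟩ | ⟨hx, hy⟩ | ⟨hx, hy⟩
  · refine hA₂ (hasFactorOfType_of_component (v := ![s, t]) (injective_two hst) ?_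
      (cartanMatrix_pair_eq_zero hc) (reflTransGen_two (by decide) (by decide)))
    intro i j
    fin_cases i <;> fin_cases j <;> simp [CartanMatrix.A, hx, hy]
  · refine hB₂ (hasFactorOfType_of_component (v := ![s, t]) (injective_two hst) ?_
      (cartanMatrix_pair_eq_zero hc) (reflTransGen_two (by decide) (by decide)))
    intro i j
    fin_cases i <;> fin_cases j <;> simp [CartanMatrix.B, hx, hy]
  -- The order is swapped to place the entry `-2` at position `(0, 1)`, as in `CartanMatrix.B 2`.
  · refine hB₂ (hasFactorOfType_of_component (v := ![t, s]) (injective_two hst.symm) ?_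
      (cartanMatrix_pair_eq_zero fun p hp hp' => (hc p hp' hp).symm)
      (reflTransGen_two (by decide) (by decide)))
    intro i j
    fin_cases i <;> fin_cases j <;> simp [CartanMatrix.B, hx, hy]

lemma exists_cartanMatrix_ne_zero_of_path (hA₃ : ¬ HasFactorOfType L (CartanMatrix.A 3))
    {s t p : b.support} (hst : s ≠ t) (hsp : s ≠ p) (htp : t ≠ p)
    (h₁ : b.cartanMatrix s t = -1) (h₂ : b.cartanMatrix t s = -1)
    (h₃ : b.cartanMatrix s p = -1) (h₄ : b.cartanMatrix p s = -1)
    (h₅ : b.cartanMatrix t p = 0) (h₆ : b.cartanMatrix p t = 0) :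
    ∃ q, s ≠ q ∧ t ≠ q ∧ p ≠ q ∧
      (b.cartanMatrix s q ≠ 0 ∨ b.cartanMatrix t q ≠ 0 ∨ b.cartanMatrix p q ≠ 0) := by
  by_contra! hc
  -- The middle node `s` goes second, matching the numbering of `CartanMatrix.A 3`.
  refine hA₃ (hasFactorOfType_of_component (v := ![t, s, p])
    (injective_three hst.symm htp hsp) ?_ ?_ ?_)
  · intro i j
    fin_cases i <;> fin_cases j <;> simp [CartanMatrix.A, h₁, h₂, h₃, h₄, h₅, h₆]
  · intro i j hj
    have h := hc j (by rintro rfl; exact hj ⟨1, rfl⟩) (by rintro rfl; exact hj ⟨0, rfl⟩)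
      (by rintro rfl; exact hj ⟨2, rfl⟩)
    fin_cases i
    · exact h.2.1
    · exact h.1
    · exact h.2.2
  · have h01 : CartanMatrix.A 3 0 1 ≠ 0 := by decide
    have h10 : CartanMatrix.A 3 1 0 ≠ 0 := by decide
    have h12 : CartanMatrix.A 3 1 2 ≠ 0 := by decide
    have h21 : CartanMatrix.A 3 2 1 ≠ 0 := by decide
    intro i j
    fin_cases i <;> fin_cases j
    · exact .refl
    · exact .single h01
    · exact .tail (.single h01) h12
    · exact .single h10
    · exact .refl
    · exact .single h12
    · exact .tail (.single h21) h10
    · exact .single h21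
    · exact .refl

variable {I : Set (rootSystem H).weylGroup}

theorem mem_of_isFat_of_length_le_one (hI : IsBruhatIdeal b I) (hfat : IsFat b I)
    (hA₁ : ¬ HasFactorOfType L (CartanMatrix.A 1)) (w : (rootSystem H).weylGroup)
    (hw : length b w ≤ 1) : w ∈ I := by
  obtain ⟨l, -, rfl, hl⟩ := exists_isReducedWord b w
  apply hfat.mem_of_bruhatLE hI
  match l, hl with
  | [], _ => exact bruhatLE_one
  | [s], _ =>
    obtain ⟨t, hst, ht⟩ := exists_cartanMatrix_ne_zero hA₁ s
    exact bruhatLE_single hst ht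
  | s :: t :: l, hl => rw [List.length_cons, List.length_cons] at hl; lia

theorem mem_of_isFat_of_length_le_two (hI : IsBruhatIdeal b I) (hfat : IsFat b I)
    (hA₁ : ¬ HasFactorOfType L (CartanMatrix.A 1)) (hA₂ : ¬ HasFactorOfType L (CartanMatrix.A 2))
    (hA₃ : ¬ HasFactorOfType L (CartanMatrix.A 3)) (hB₂ : ¬ HasFactorOfType L (CartanMatrix.B 2))
    (w : (rootSystem H).weylGroup) (hw : length b w ≤ 2) : w ∈ I := by
  by_cases hw1 : length b w ≤ 1
  · exact mem_of_isFat_of_length_le_one hI hfat hA₁ w hw1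
  obtain ⟨l, hred, rfl, hl⟩ := exists_isReducedWord b w
  apply hfat.mem_of_bruhatLE hI
  obtain ⟨s, t, rfl⟩ := List.length_eq_two.1 (show l.length = 2 by lia)
  have hst : s ≠ t := by
    rintro rfl
    have := hred [] (by simp [ofIdx_mul_self])
    simp at this
  exact bruhatLE_pair (exists_cartanMatrix_ne_zero hA₁)
    (fun _ _ => exists_cartanMatrix_ne_zero_of_pair hA₂ hB₂)
    (fun _ _ _ => exists_cartanMatrix_ne_zero_of_path hA₃) hst

end SmallComponents

end

end WeylIdeals

end

theorem mainTheorem11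
    -- `G` is a complex semisimple Lie group
    {E : Type*} [NormedAddCommGroup E] [NormedSpace ℂ E] [FiniteDimensional ℂ E]
    {G : Type*} [TopologicalSpace G] [ChartedSpace E G] [Group G]
    [LieGroup 𝓘(ℂ, E) (minSmoothness ℂ 3) G] [Finite (ConnectedComponents G)]
    [LieAlgebra.IsSemisimple ℂ (GroupLieAlgebra 𝓘(ℂ, E) G)]
    -- a Cartan subalgebra of its Lie algebra, and a system of simple roots
    (H : LieSubalgebra ℂ (GroupLieAlgebra 𝓘(ℂ, E) G)) [H.IsCartanSubalgebra]
    (b : (LieAlgebra.IsKilling.rootSystem H).Base)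
    -- a fat Chevalley-Bruhat ideal in the Weyl group
    (I : Set (LieAlgebra.IsKilling.rootSystem H).weylGroup)
    (hI : WeylIdeals.IsBruhatIdeal b I) (hfat : WeylIdeals.IsFat b I) :
    (¬ WeylIdeals.HasFactorOfType (GroupLieAlgebra 𝓘(ℂ, E) G) (CartanMatrix.A 1) →
      ∀ w : (LieAlgebra.IsKilling.rootSystem H).weylGroup,
        WeylIdeals.length b w ≤ 1 → w ∈ I) ∧
    (¬ WeylIdeals.HasFactorOfType (GroupLieAlgebra 𝓘(ℂ, E) G) (CartanMatrix.A 1) →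
      ¬ WeylIdeals.HasFactorOfType (GroupLieAlgebra 𝓘(ℂ, E) G) (CartanMatrix.A 2) →
      ¬ WeylIdeals.HasFactorOfType (GroupLieAlgebra 𝓘(ℂ, E) G) (CartanMatrix.A 3) →
      ¬ WeylIdeals.HasFactorOfType (GroupLieAlgebra 𝓘(ℂ, E) G) (CartanMatrix.B 2) →
      ∀ w : (LieAlgebra.IsKilling.rootSystem H).weylGroup,
        WeylIdeals.length b w ≤ 2 → w ∈ I) := by
  exact ⟨WeylIdeals.mem_of_isFat_of_length_le_one hI hfat,
    WeylIdeals.mem_of_isFat_of_length_le_two hI hfat⟩
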